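/- Fix a period $T>0$ and a central mass $m_0\ge 0$. Let $\{I,R_2,R_3,R_4\}\cong\mathbb{Z}_2\times\mathbb{Z}_2$ be the Klein group, where $R_2=\mathrm{diag}(1,-1,-1)$, $R_3=\mathrm{diag}(-1,1,-1)$, $R_4=\mathrm{diag}(-1,-1,1)$ are the rotations of $\pi$ around the coordinate axes of $\mathbb{R}^3$, and let $\Gamma=\{x\in\mathbb{R}^3: Rx=x \text{ for some } R\in\{R_2,R_3,R_4\}\}$ be the union of the three coordinate axes. Let $\widetilde R_j$ be the reflection with respect to the plane $\{x_j=0\}$, and let $S_1=\{\alpha e_1+\beta e_2:\alpha,\beta>0\}$, $S_2=\{-\alpha e_1+\beta e_3:\alpha,\beta>0\}$. Denote by $\mathcal{K}$ the set of $T$-periodic $H^1$ loops $u_I:\mathbb{R}\to\mathbb{R}^3\setminus\Gamma$ such that, for all $t\in\mathbb{R}$, \[ u_I(t)=\widetilde R_3\,u_I(-t),\qquad u_I(t)=\widetilde R_2\,u_I(T/2-t), \] and $u_I(0)\in S_1$, $u_I(T/4)\in S_2$. Let $\overline{\mathcal{K}}$ be the closure of $\mathcal{K}$ in the $H^1$ norm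 on $T$-periodic loops in $\mathbb{R}^3$. To a loop $u_I$ associate the motion of four satellites of unit mass $u_R(t)=R\,u_I(t)$, $R\in\{I,R_2,R_3,R_4\}$, with a central body of mass $m_0$ at rest at the origin, and its Newtonian Lagrangian action \[ \mathcal{A}(u_I)=\int_0^T\Big(\tfrac12\sum_{R}|\dot u_R|^2+\sum_R\frac{m_0}{|u_R|}+\sum_{\{R,R'\},\,R\ne R'}\frac{1}{|u_R-u_{R'}|}\Big)dt =4\int_0^T\Big(\frac{|\dot u_I|^2}{2}+\frac{m_0}{|u_I|}+\frac12\sum_{R\neq I}\frac{1}{|(R-I)u_I|}\Big)dt\in[0,+\infty]. \] Then every minimizer $u_I^*$ of $\mathcal{A}$ over $\overline{\mathcal{K}}$ is free of total collisions: there is no time $t$ at which all the satellites are at the origin (equivalently, $u_I^*(t)\neq 0$ for every $t\in\mathbb{R}$). -/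

import Mathlib

open MeasureTheory Set
open scoped ENNReal

namespace KleinSatellites

/-- Three-dimensional Euclidean space. -/
abbrev E3 : Type := EuclideanSpace ℝ (Fin 3)

/-! ### The rotations of the Klein group and the coordinate reflections -/

/-- The elements `I, R₂, R₃, R₄` of the Klein group `ℤ₂ × ℤ₂`: the identity and the rotations
of angle `π` around the three coordinate axes. -/
def kleinMatrix : Fin 4 → Matrix (Fin 3) (Fin 3) ℝ :=
  ![1,
    !![1, 0, 0; 0, -1, 0; 0, 0, -1],
    !![-1, 0, 0; 0, 1, 0; 0, 0, -1],
    !![-1, 0, 0; 0, -1, 0; 0, 0, 1]]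

/-- The linear isometry of `ℝ³` given by an element of the Klein group. -/
noncomputable def kleinRot (i : Fin 4) : E3 →ₗ[ℝ] E3 :=
  Matrix.toEuclideanLin (kleinMatrix i)

/-- The reflection of `ℝ³` with respect to the coordinate plane `{x_j = 0}` (coordinates are
numbered from `0`, so `j = 1` is the plane `{x₂ = 0}` and `j = 2` the plane `{x₃ = 0}`). -/
noncomputable def coordReflection (j : Fin 3) : E3 →ₗ[ℝ] E3 :=
  Matrix.toEuclideanLin (Matrix.diagonal fun k => if k = j then (-1 : ℝ) else 1)

/-- The collision set: the points fixed by some rotation of the group other than the identity. -/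
def collisionSet : Set E3 := {x | ∃ i : Fin 4, i ≠ 0 ∧ kleinRot i x = x}

/-! ### The action of the `(1+4)`-body problem -/

/-- The configuration of the four satellites determined by the generating particle:
`u_R = R u_I` for every `R` in the group. -/
noncomputable def satellites (u : ℝ → E3) (i : Fin 4) (t : ℝ) : E3 := kleinRot i (u t)

/-- The kinetic energy `(1/2) ∑ |w_i|²` of four satellites of unit mass with velocities `w_i`,
as an extended non-negative number. -/
noncomputable def kineticEnergy (w : Fin 4 → E3) : ℝ≥0∞ := (∑ i, ‖w i‖ₑ ^ 2) / 2

/-- The Newtonian potential `∑ m₀ / |x_i| + ∑_{i<j} 1 / |x_i - x_j|` of four satellites of unit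
mass and a central body of mass `m₀` at the origin, with value `∞` when two satellites coincide. -/
noncomputable def potential (m₀ : ℝ) (x : Fin 4 → E3) : ℝ≥0∞ :=
  (∑ i, ENNReal.ofReal m₀ / ‖x i‖ₑ) + ∑ i, ∑ j ∈ Finset.Ioi i, 1 / ‖x i - x j‖ₑ

/-- The Lagrangian action, over one period, of the symmetric motion of the four satellites
generated by `u`, with values in `[0, ∞]`. -/
noncomputable def action (m₀ T : ℝ) (u : ℝ → E3) : ℝ≥0∞ :=
  ∫⁻ t in Ioc 0 T,
    (kineticEnergy (fun i => deriv (satellites u i) t) + potential m₀ (fun i => satellites u i t))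

/-! ### Sobolev loops -/

/-- `u` is (the continuous representative of) a `T`-periodic loop of class `H¹`: it is
`T`-periodic, absolutely continuous on a period, and its derivative, which exists almost
everywhere, is square integrable on a period. -/
structure IsH1Loop (T : ℝ) (u : ℝ → E3) : Prop where
  periodic : Function.Periodic u T
  absolutelyContinuous : AbsolutelyContinuousOnInterval u 0 T
  memLp_deriv : MemLp (deriv u) 2 (volume.restrict (Ioc 0 T))

/-- The distance of two loops in the `H¹` norm
`‖u‖² = ∫₀ᵀ |u|² + |u̇|²`. -/
noncomputable def h1Dist (T : ℝ) (u v : ℝ → E3) : ℝ≥0∞ :=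
  (∫⁻ t in Ioc 0 T, (‖u t - v t‖ₑ ^ 2 + ‖deriv u t - deriv v t‖ₑ ^ 2)) ^ (1 / 2 : ℝ)

/-- The closure, in the space of `T`-periodic `H¹` loops, of a set of loops. -/
def h1Closure (T : ℝ) (K : Set (ℝ → E3)) : Set (ℝ → E3) :=
  {u | IsH1Loop T u ∧ ∀ ε : ℝ≥0∞, 0 < ε → ∃ v ∈ K, h1Dist T u v < ε}

/-! ### The set of admissible loops -/

/-- The open quadrant `{α e₁ + β e₂ : α, β > 0}`. -/
def quadrantS1 : Set E3 := {x | ∃ α β : ℝ, 0 < α ∧ 0 < β ∧ x = !₂[α, β, 0]}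

/-- The open quadrant `{-α e₁ + β e₃ : α, β > 0}`. -/
def quadrantS2 : Set E3 := {x | ∃ α β : ℝ, 0 < α ∧ 0 < β ∧ x = !₂[-α, 0, β]}

/-- The set `𝒦` of admissible motions of the generating particle: the `T`-periodic `H¹` loops
in `ℝ³ \ Γ` with the two reflection symmetries and the two quadrant conditions. -/
def admissibleLoops (T : ℝ) : Set (ℝ → E3) :=
  {u | IsH1Loop T u ∧ (∀ t, u t ∉ collisionSet) ∧
    (∀ t, u t = coordReflection 2 (u (-t))) ∧
    (∀ t, u t = coordReflection 1 (u (T / 2 - t))) ∧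
    u 0 ∈ quadrantS1 ∧ u (T / 4) ∈ quadrantS2}

/-- The motion generated by `u` has a total collision: at some time all the satellites are at
the origin, where the central body is. -/
def HasTotalCollision (u : ℝ → E3) : Prop := ∃ t, ∀ i, satellites u i t = 0

end KleinSatellites

/-!
Every distance between two satellites is twice the distance of the generating particle from a
coordinate axis, hence at most `2 |u|`, so the action is at least four times the Kepler action with
central mass `m₀ + 3 / 4`. The symmetries give `|u (t + T / 2)| = |u t|`, so a loop of the closure
which collides does so in both halves of the period, and each half costs at least Gordon's
bound `3 (π² α² L / 2) ^ (1 / 3)` for a Kepler motion of duration `L` through the origin. That bound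
follows from Young's inequality, which compares the Lagrangian with the derivative of the
characteristic function of the rectilinear motion having the same apocentre, and from the
arithmetic-geometric mean inequality in the apocentre. A loop shaped like the seam of a tennis ball
has a strictly smaller action.
-/

open Filter Topology
open scoped NNReal Real

namespace KleinSatellites

section AbsolutelyContinuous

variable {E : Type*} [NormedAddCommGroup E] {u : ℝ → E} {a b p q t : ℝ}

theorem absolutelyContinuousOnInterval_comp {X Y : Type*} [PseudoMetricSpace X]
    [PseudoMetricSpace Y] {f : X → Y} {g : ℝ → X} {s : Set X} {K : ℝ≥0}
    (hf : LipschitzOnWith K f s) (hg : AbsolutelyContinuousOnInterval g a b)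
    (hgs : MapsTo g (uIcc a b) s) : AbsolutelyContinuousOnInterval (f ∘ g) a b := by
  have hK : Tendsto (fun I : ℕ × (ℕ → ℝ × ℝ) =>
      K * ∑ i ∈ Finset.range I.1, dist (g (I.2 i).1) (g (I.2 i).2))
      (AbsolutelyContinuousOnInterval.totalLengthFilter ⊓
        𝓟 (AbsolutelyContinuousOnInterval.disjWithin a b)) (𝓝 0) := by
    simpa only [mul_zero] using Tendsto.const_mul (K : ℝ) hg
  refine squeeze_zero' (Eventually.of_forall fun _ => Finset.sum_nonneg fun _ _ => dist_nonneg)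
    (eventually_inf_principal.2 (Eventually.of_forall fun I hI => ?_)) hK
  rw [Finset.mul_sum]
  exact Finset.sum_le_sum fun i hi =>
    hf.dist_le_mul _ (hgs (hI.1 i hi).1) _ (hgs (hI.1 i hi).2)

theorem absolutelyContinuousOnInterval_norm (hu : AbsolutelyContinuousOnInterval u a b) :
    AbsolutelyContinuousOnInterval (fun t => ‖u t‖) a b :=
  absolutelyContinuousOnInterval_comp (lipschitzWith_one_norm.lipschitzOnWith (s := univ)) hu
    (mapsTo_univ _ _)

theorem ae_differentiableAt_of_absolutelyContinuousOnInterval [NormedSpace ℝ E]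
    [FiniteDimensional ℝ E] (hu : AbsolutelyContinuousOnInterval u a b) (hab : a ≤ b) :
    ∀ᵐ t ∂volume.restrict (Ioc a b), DifferentiableAt ℝ u t := by
  rw [ae_restrict_iff' measurableSet_Ioc]
  filter_upwards [hu.boundedVariationOn.ae_differentiableAt_of_mem_uIcc] with t hut ht
  exact hut (uIcc_of_le hab ▸ Ioc_subset_Icc_self ht)

theorem abs_deriv_norm_le [NormedSpace ℝ E] (hu : DifferentiableAt ℝ u t) :
    |deriv (fun s => ‖u s‖) t| ≤ ‖deriv u t‖ := by
  by_cases hn : DifferentiableAt ℝ (fun s => ‖u s‖) t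
  · refine le_of_tendsto_of_tendsto (hasDerivAt_iff_tendsto_slope.1 hn.hasDerivAt).abs
      (hasDerivAt_iff_tendsto_slope.1 hu.hasDerivAt).norm (Eventually.of_forall fun s => ?_)
    simp only [slope_def_module, norm_smul, smul_eq_mul, abs_mul, Real.norm_eq_abs]
    exact mul_le_mul_of_nonneg_left (abs_norm_sub_norm_le _ _) (abs_nonneg _)
  · simp only [deriv_zero_of_not_differentiableAt hn, abs_zero, norm_nonneg]

theorem setLIntegral_Ioc_add_adjacent (f : ℝ → ℝ≥0∞) (hap : a ≤ p) (hpb : p ≤ b) :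
    (∫⁻ t in Ioc a p, f t) + ∫⁻ t in Ioc p b, f t = ∫⁻ t in Ioc a b, f t := by
  rw [← lintegral_union measurableSet_Ioc (Ioc_disjoint_Ioc_of_le le_rfl),
    Ioc_union_Ioc_eq_Ioc hap hpb]

theorem enorm_sub_le_lintegral_enorm_deriv {H : ℝ → ℝ} (hH : AbsolutelyContinuousOnInterval H a b)
    (hab : a ≤ b) : ‖H b - H a‖ₑ ≤ ∫⁻ t in Ioc a b, ‖deriv H t‖ₑ := by
  rw [← hH.integral_deriv_eq_sub, intervalIntegral.integral_of_le hab]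
  exact enorm_integral_le_lintegral_enorm _

theorem absolutelyContinuousOnInterval_mono_Icc {X : Type*} [PseudoMetricSpace X] {f : ℝ → X}
    (hf : AbsolutelyContinuousOnInterval f a b) (hap : a ≤ p) (hpq : p ≤ q) (hqb : q ≤ b) :
    AbsolutelyContinuousOnInterval f p q :=
  hf.mono (by
    rw [uIcc_of_le hpq, uIcc_of_le (hap.trans (hpq.trans hqb))]
    exact Icc_subset_Icc hap hqb)

theorem enorm_sub_le_lintegral_enorm_deriv_of_mem {H : ℝ → ℝ}
    (hH : AbsolutelyContinuousOnInterval H a b) (hp : p ∈ Icc a b) (hq : q ∈ Icc a b) :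
    ‖H q - H p‖ₑ ≤ ∫⁻ t in Ioc a b, ‖deriv H t‖ₑ := by
  wlog hpq : p ≤ q generalizing p q
  · rw [enorm_sub_rev]
    exact this hq hp (not_le.1 hpq).le
  exact (enorm_sub_le_lintegral_enorm_deriv
    (absolutelyContinuousOnInterval_mono_Icc hH hp.1 hpq hq.2) hpq).trans
    (lintegral_mono_set (Ioc_subset_Ioc hp.1 hq.2))

theorem two_mul_enorm_sub_le_lintegral_enorm_deriv {H : ℝ → ℝ}
    (hH : AbsolutelyContinuousOnInterval H a b) (hab : H a = H b) (hp : p ∈ Icc a b)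
    (hq : q ∈ Icc a b) : 2 * ‖H q - H p‖ₑ ≤ ∫⁻ t in Ioc a b, ‖deriv H t‖ₑ := by
  wlog hpq : p ≤ q generalizing p q
  · rw [enorm_sub_rev]
    exact this hq hp (not_le.1 hpq).le
  have h_before := enorm_sub_le_lintegral_enorm_deriv
    (absolutelyContinuousOnInterval_mono_Icc hH le_rfl hp.1 hp.2) hp.1
  have h_between := enorm_sub_le_lintegral_enorm_deriv
    (absolutelyContinuousOnInterval_mono_Icc hH hp.1 hpq hq.2) hpq
  have h_after := enorm_sub_le_lintegral_enorm_deriv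
    (absolutelyContinuousOnInterval_mono_Icc hH hq.1 hq.2 le_rfl) hq.2
  have h_around : ‖H q - H p‖ₑ ≤ ‖H p - H a‖ₑ + ‖H b - H q‖ₑ := by
    calc ‖H q - H p‖ₑ = ‖(H p - H a) + (H b - H q)‖ₑ := by
          rw [enorm_sub_rev, hab]; congr 1; ring
      _ ≤ _ := enorm_add_le _ _
  calc 2 * ‖H q - H p‖ₑ ≤ (‖H p - H a‖ₑ + ‖H b - H q‖ₑ) + ‖H q - H p‖ₑ := by
        rw [two_mul]; gcongr
    _ = ‖H p - H a‖ₑ + (‖H q - H p‖ₑ + ‖H b - H q‖ₑ) := by ring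
    _ ≤ (∫⁻ t in Ioc a p, ‖deriv H t‖ₑ) +
        ((∫⁻ t in Ioc p q, ‖deriv H t‖ₑ) + ∫⁻ t in Ioc q b, ‖deriv H t‖ₑ) := by gcongr
    _ = ∫⁻ t in Ioc a b, ‖deriv H t‖ₑ := by
        rw [setLIntegral_Ioc_add_adjacent _ hpq hq.2, setLIntegral_Ioc_add_adjacent _ hp.1 hp.2]

theorem enorm_deriv_norm_sq_le [InnerProductSpace ℝ E] (hu : DifferentiableAt ℝ u t) :
    ‖deriv (fun s => ‖u s‖ ^ 2) t‖ₑ ≤ ‖u t‖ₑ ^ 2 + ‖deriv u t‖ₑ ^ 2 := by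
  rw [hu.hasDerivAt.norm_sq.deriv]
  simp only [← ofReal_norm, ← ENNReal.ofReal_pow (norm_nonneg _)]
  rw [← ENNReal.ofReal_add (sq_nonneg _) (sq_nonneg _)]
  refine ENNReal.ofReal_le_ofReal ?_
  rw [norm_mul, Real.norm_ofNat]
  nlinarith [norm_inner_le_norm (𝕜 := ℝ) (u t) (deriv u t), sq_nonneg (‖u t‖ - ‖deriv u t‖)]

theorem mul_sq_enorm_le_lintegral [InnerProductSpace ℝ E] [FiniteDimensional ℝ E]
    (hu : AbsolutelyContinuousOnInterval u a b) (ht : t ∈ Icc a b) :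
    ENNReal.ofReal (b - a) * ‖u t‖ₑ ^ 2 ≤
      (1 + ENNReal.ofReal (b - a)) * ∫⁻ s in Ioc a b, (‖u s‖ₑ ^ 2 + ‖deriv u s‖ₑ ^ 2) := by
  set D := ∫⁻ s in Ioc a b, (‖u s‖ₑ ^ 2 + ‖deriv u s‖ₑ ^ 2)
  have hab : a ≤ b := ht.1.trans ht.2
  have hsq : AbsolutelyContinuousOnInterval (fun s => ‖u s‖ ^ 2) a b := by
    simpa only [sq] using (absolutelyContinuousOnInterval_norm hu).fun_mul
      (absolutelyContinuousOnInterval_norm hu)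
  have hderiv : ∀ᵐ s ∂volume.restrict (Ioc a b),
      ‖deriv (fun s => ‖u s‖ ^ 2) s‖ₑ ≤ ‖u s‖ₑ ^ 2 + ‖deriv u s‖ₑ ^ 2 := by
    filter_upwards [ae_differentiableAt_of_absolutelyContinuousOnInterval hu hab] with s hs
    exact enorm_deriv_norm_sq_le hs
  have hosc : ∀ s ∈ Ioc a b, ‖u t‖ₑ ^ 2 ≤ ‖u s‖ₑ ^ 2 + D := fun s hs => by
    have h : ‖‖u t‖ ^ 2 - ‖u s‖ ^ 2‖ₑ ≤ D :=
      (enorm_sub_le_lintegral_enorm_deriv_of_mem hsq (Ioc_subset_Icc_self hs) ht).trans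
        (lintegral_mono_ae hderiv)
    calc ‖u t‖ₑ ^ 2 = ‖‖u s‖ ^ 2 + (‖u t‖ ^ 2 - ‖u s‖ ^ 2)‖ₑ := by
          rw [add_sub_cancel, enorm_pow, enorm_norm]
      _ ≤ ‖‖u s‖ ^ 2‖ₑ + ‖‖u t‖ ^ 2 - ‖u s‖ ^ 2‖ₑ := enorm_add_le _ _
      _ ≤ ‖u s‖ₑ ^ 2 + D := by rw [enorm_pow, enorm_norm]; gcongr
  calc ENNReal.ofReal (b - a) * ‖u t‖ₑ ^ 2 = ∫⁻ _ in Ioc a b, ‖u t‖ₑ ^ 2 := by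
        rw [setLIntegral_const, Real.volume_Ioc, mul_comm]
    _ ≤ ∫⁻ s in Ioc a b, (‖u s‖ₑ ^ 2 + D) := setLIntegral_mono' measurableSet_Ioc hosc
    _ = (∫⁻ s in Ioc a b, ‖u s‖ₑ ^ 2) + ENNReal.ofReal (b - a) * D := by
        rw [lintegral_add_right _ measurable_const, setLIntegral_const, Real.volume_Ioc, mul_comm D]
    _ ≤ D + ENNReal.ofReal (b - a) * D := by
        gcongr ?_ + _
        exact lintegral_mono fun s => le_self_add
    _ = (1 + ENNReal.ofReal (b - a)) * D := by rw [add_mul, one_mul]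

end AbsolutelyContinuous

section Kepler

variable {E : Type*} [NormedAddCommGroup E] {u : ℝ → E} {a b p q α R δ ρ : ℝ}

/-- The Lagrangian `|v|² / 2 + α / |x|` of a particle at `x` with velocity `v`, attracted by a
fixed mass `α` at the origin, where it takes the value `∞` if `0 < α`. -/
noncomputable def keplerLagrangian (α : ℝ) (x v : E) : ℝ≥0∞ :=
  ‖v‖ₑ ^ 2 / 2 + ENNReal.ofReal α / ‖x‖ₑ

/-- The action of the Kepler problem along the motion `u` between the times `a` and `b`. -/
noncomputable def keplerAction [NormedSpace ℝ E] (α a b : ℝ) (u : ℝ → E) : ℝ≥0∞ :=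
  ∫⁻ t in Ioc a b, keplerLagrangian α (u t) (deriv u t)

theorem keplerAction_add_adjacent [NormedSpace ℝ E] (hap : a ≤ p) (hpb : p ≤ b) :
    keplerAction α a p u + keplerAction α p b u = keplerAction α a b u :=
  setLIntegral_Ioc_add_adjacent _ hap hpb

theorem keplerAction_eq_top [NormedSpace ℝ E] (hα : 0 < α) (hab : a < b)
    (hu : ∀ t ∈ Icc a b, u t = 0) :
    keplerAction α a b u = ⊤ := by
  have htop : ∀ t ∈ Ioc a b, keplerLagrangian α (u t) (deriv u t) = ⊤ := fun t ht => by
    rw [keplerLagrangian, hu t (Ioc_subset_Icc_self ht), enorm_zero,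
      ENNReal.div_zero (ENNReal.ofReal_pos.2 hα).ne', add_top]
  rw [keplerAction, setLIntegral_congr_fun measurableSet_Ioc htop, setLIntegral_const,
    Real.volume_Ioc, ENNReal.top_mul (ENNReal.ofReal_pos.2 (sub_pos.2 hab)).ne']

/-- Hamilton's characteristic function of the rectilinear Kepler motion from the origin to the
distance `ρ` with energy `-α / R`, that is, with apocentre `R`: the solution of
`W'(ρ)² / 2 - α / ρ = -α / R` with `W(0) = 0`. -/
noncomputable def keplerCharacteristic (α R ρ : ℝ) : ℝ :=
  √(2 * α * R) * (√(ρ / R) * √(1 - ρ / R) + Real.arcsin √(ρ / R))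

theorem keplerCharacteristic_zero (α R : ℝ) : keplerCharacteristic α R 0 = 0 := by
  simp only [keplerCharacteristic, zero_div, Real.sqrt_zero, zero_mul, Real.arcsin_zero, add_zero,
    mul_zero]

theorem keplerCharacteristic_self (hR : R ≠ 0) :
    keplerCharacteristic α R R = √(2 * α * R) * (π / 2) := by
  simp only [keplerCharacteristic, div_self hR, sub_self, Real.sqrt_zero, mul_zero,
    Real.sqrt_one, Real.arcsin_one, zero_add]

theorem hasDerivAt_sqrt_mul_sqrt_add_arcsin_sqrt {x : ℝ} (h₀ : 0 < x) (h₁ : x < 1) :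
    HasDerivAt (fun x => √x * √(1 - x) + Real.arcsin √x) (√(1 - x) / √x) x := by
  have hs : 0 < √x := Real.sqrt_pos.2 h₀
  have hc : 0 < √(1 - x) := Real.sqrt_pos.2 (sub_pos.2 h₁)
  have hs1 : √x < 1 := by rwa [Real.sqrt_lt' one_pos, one_pow]
  have hsq : √x ^ 2 = x := Real.sq_sqrt h₀.le
  have hcq : √(1 - x) ^ 2 = 1 - x := Real.sq_sqrt (sub_pos.2 h₁).le
  have hd_sqrt := (hasDerivAt_id x).sqrt h₀.ne'
  have hd_sqrt_sub := ((hasDerivAt_id x).const_sub 1).sqrt (sub_pos.2 h₁).ne'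
  have hd_arcsin := (Real.hasDerivAt_arcsin (by linarith) hs1.ne).comp x hd_sqrt
  convert! (hd_sqrt.mul hd_sqrt_sub).add hd_arcsin using 1
  simp only [id, hsq]
  field_simp
  linear_combination hcq + hsq

theorem hasDerivAt_keplerCharacteristic (hα : 0 ≤ α) (h₀ : 0 < ρ) (h₁ : ρ < R) :
    HasDerivAt (keplerCharacteristic α R) √(2 * (α / ρ - α / R)) ρ := by
  have hR : 0 < R := h₀.trans h₁
  have hx : ρ / R < 1 := (div_lt_one hR).2 h₁
  convert! ((hasDerivAt_sqrt_mul_sqrt_add_arcsin_sqrt (div_pos h₀ hR) hx).comp ρ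
    ((hasDerivAt_id ρ).div_const R)).const_mul √(2 * α * R) using 1
  calc √(2 * (α / ρ - α / R)) = √(2 * α * R * ((1 - ρ / R) / (ρ / R)) * (1 / R) ^ 2) := by
        congr 1; field_simp
    _ = √(2 * α * R) * (√(1 - ρ / R) / √(ρ / R) * (1 / R)) := by
        rw [Real.sqrt_mul (mul_nonneg (by positivity)
          (div_nonneg (sub_pos.2 hx).le (by positivity))), Real.sqrt_mul (by positivity),
          Real.sqrt_div (sub_pos.2 hx).le, Real.sqrt_sq (by positivity), mul_assoc]

theorem lipschitzOnWith_keplerCharacteristic (hα : 0 ≤ α) (hδ : 0 < δ) :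
    LipschitzOnWith (√(2 * (α / δ))).toNNReal (keplerCharacteristic α R) (Ico δ R) := by
  refine (convex_Ico δ R).lipschitzOnWith_of_nnnorm_hasDerivWithin_le (fun ρ hρ =>
    (hasDerivAt_keplerCharacteristic hα (hδ.trans_le hρ.1) hρ.2).hasDerivWithinAt)
    fun ρ hρ => ?_
  have hR : 0 < R := hδ.trans_le (hρ.1.trans hρ.2.le)
  rw [← NNReal.coe_le_coe, coe_nnnorm, Real.coe_toNNReal _ (Real.sqrt_nonneg _),
    Real.norm_of_nonneg (Real.sqrt_nonneg _)]
  have hle : α / ρ ≤ α / δ := div_le_div_of_nonneg_left hα hδ hρ.1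
  gcongr
  linarith [div_nonneg hα hR.le]

theorem ofReal_add_ofReal_le_keplerLagrangian (hα : 0 ≤ α) {x v : E} (hx : ‖x‖ ≤ ρ)
    (h₀ : 0 < ρ) (h₁ : ρ ≤ R) :
    ENNReal.ofReal (α / R) + ENNReal.ofReal (√(2 * (α / ρ - α / R)) * ‖v‖) ≤
      keplerLagrangian α x v := by
  have hle : α / R ≤ α / ρ := div_le_div_of_nonneg_left hα h₀ h₁
  have hsq : √(2 * (α / ρ - α / R)) ^ 2 = 2 * (α / ρ - α / R) := Real.sq_sqrt (by linarith)
  have hyoung : α / R + √(2 * (α / ρ - α / R)) * ‖v‖ ≤ ‖v‖ ^ 2 / 2 + α / ρ := by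
    linarith [sq_nonneg (√(2 * (α / ρ - α / R)) - ‖v‖)]
  calc ENNReal.ofReal (α / R) + ENNReal.ofReal (√(2 * (α / ρ - α / R)) * ‖v‖)
      = ENNReal.ofReal (α / R + √(2 * (α / ρ - α / R)) * ‖v‖) :=
        (ENNReal.ofReal_add (div_nonneg hα (h₀.le.trans h₁)) (by positivity)).symm
    _ ≤ ENNReal.ofReal (‖v‖ ^ 2 / 2 + α / ρ) := ENNReal.ofReal_le_ofReal hyoung
    _ = ‖v‖ₑ ^ 2 / 2 + ENNReal.ofReal α / ENNReal.ofReal ρ := by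
        rw [ENNReal.ofReal_add (by positivity) (div_nonneg hα h₀.le),
          ENNReal.ofReal_div_of_pos two_pos, ENNReal.ofReal_div_of_pos h₀,
          ENNReal.ofReal_pow (norm_nonneg v), ofReal_norm, ENNReal.ofReal_ofNat]
    _ ≤ keplerLagrangian α x v := by
        rw [keplerLagrangian, ← ofReal_norm x]
        gcongr

theorem three_mul_rpow_le_add_two_mul {x y : ℝ} (hx : 0 ≤ x) (hy : 0 ≤ y) :
    3 * (x * y ^ 2) ^ (1 / 3 : ℝ) ≤ x + 2 * y := by
  have h := Real.geom_mean_le_arith_mean2_weighted (w₁ := 1 / 3) (w₂ := 2 / 3) (by norm_num)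
    (by norm_num) hx hy (by norm_num)
  have hxy : (x * y ^ 2) ^ (1 / 3 : ℝ) = x ^ (1 / 3 : ℝ) * y ^ (2 / 3 : ℝ) := by
    rw [Real.mul_rpow hx (sq_nonneg y), ← Real.rpow_natCast_mul hy]
    norm_num
  linarith

-- `keplerCharacteristic α R` is not Lipschitz near `0`, so the distance to the origin is
-- shifted by `δ`; this only lowers the potential.
theorem ofReal_add_enorm_deriv_keplerCharacteristic_le_keplerLagrangian [NormedSpace ℝ E] {t : ℝ}
    (hα : 0 ≤ α) (hδ : 0 < δ) (hR : ‖u t‖ + δ < R) (hu : DifferentiableAt ℝ u t)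
    (hn : DifferentiableAt ℝ (fun s => ‖u s‖) t) :
    ENNReal.ofReal (α / R) + ‖deriv (fun s => keplerCharacteristic α R (‖u s‖ + δ)) t‖ₑ ≤
      keplerLagrangian α (u t) (deriv u t) := by
  have hpos : 0 < ‖u t‖ + δ := by positivity
  have hderiv : HasDerivAt (fun s => keplerCharacteristic α R (‖u s‖ + δ))
      (√(2 * (α / (‖u t‖ + δ) - α / R)) * deriv (fun s => ‖u s‖) t) t :=
    (hasDerivAt_keplerCharacteristic hα hpos hR).comp (h := fun s => ‖u s‖ + δ) t
      (hn.hasDerivAt.add_const δ)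
  refine le_trans ?_ (ofReal_add_ofReal_le_keplerLagrangian hα (v := deriv u t)
    (le_add_of_nonneg_right hδ.le) hpos hR.le)
  gcongr
  rw [← ofReal_norm, hderiv.deriv, norm_mul, Real.norm_of_nonneg (Real.sqrt_nonneg _)]
  gcongr
  exact abs_deriv_norm_le hu

variable [NormedSpace ℝ E] [FiniteDimensional ℝ E]

theorem add_two_mul_enorm_keplerCharacteristic_sub_le_keplerAction (hα : 0 ≤ α) (hδ : 0 < δ)
    (hu : AbsolutelyContinuousOnInterval u a b) (hR : ∀ t ∈ Icc a b, ‖u t‖ + δ < R)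
    (hab : ‖u a‖ = ‖u b‖) (hp : p ∈ Icc a b) (hq : q ∈ Icc a b) :
    ENNReal.ofReal (α / R) * ENNReal.ofReal (b - a) +
      2 * ‖keplerCharacteristic α R (‖u q‖ + δ) - keplerCharacteristic α R (‖u p‖ + δ)‖ₑ ≤
      keplerAction α a b u := by
  have hle : a ≤ b := hp.1.trans hp.2
  have hmem : ∀ t ∈ Icc a b, ‖u t‖ + δ ∈ Ico δ R := fun t ht =>
    ⟨le_add_of_nonneg_left (norm_nonneg _), hR t ht⟩
  let H : ℝ → ℝ := keplerCharacteristic α R ∘ fun t => ‖u t‖ + δ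
  have hnorm := absolutelyContinuousOnInterval_norm hu
  have hshift : AbsolutelyContinuousOnInterval (fun t => ‖u t‖ + δ) a b :=
    hnorm.add (LipschitzWith.const δ).lipschitzOnWith.absolutelyContinuousOnInterval
  have hH : AbsolutelyContinuousOnInterval H a b :=
    absolutelyContinuousOnInterval_comp (lipschitzOnWith_keplerCharacteristic hα hδ) hshift
      fun t ht => hmem t (by rwa [uIcc_of_le hle] at ht)
  have hlagrangian : ∀ᵐ t ∂volume.restrict (Ioc a b),
      ENNReal.ofReal (α / R) + ‖deriv H t‖ₑ ≤ keplerLagrangian α (u t) (deriv u t) := by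
    filter_upwards [ae_restrict_mem measurableSet_Ioc,
      ae_differentiableAt_of_absolutelyContinuousOnInterval hu hle,
      ae_differentiableAt_of_absolutelyContinuousOnInterval hnorm hle] with t ht hut hnt
    exact ofReal_add_enorm_deriv_keplerCharacteristic_le_keplerLagrangian hα hδ
      (hR t (Ioc_subset_Icc_self ht)) hut hnt
  have hosc : 2 * ‖H q - H p‖ₑ ≤ ∫⁻ t in Ioc a b, ‖deriv H t‖ₑ :=
    two_mul_enorm_sub_le_lintegral_enorm_deriv hH (by simp only [H, Function.comp_apply, hab]) hp hq
  calc ENNReal.ofReal (α / R) * ENNReal.ofReal (b - a) + 2 * ‖H q - H p‖ₑ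
      ≤ ENNReal.ofReal (α / R) * ENNReal.ofReal (b - a) + ∫⁻ t in Ioc a b, ‖deriv H t‖ₑ := by
        gcongr
    _ = ∫⁻ t in Ioc a b, (ENNReal.ofReal (α / R) + ‖deriv H t‖ₑ) := by
        rw [lintegral_add_left measurable_const, setLIntegral_const, Real.volume_Ioc]
    _ ≤ keplerAction α a b u := lintegral_mono_ae hlagrangian

theorem ofReal_add_pi_mul_sqrt_le_keplerAction (hα : 0 ≤ α)
    (hu : AbsolutelyContinuousOnInterval u a b) (hR : 0 < R) (hle : ∀ t ∈ Icc a b, ‖u t‖ ≤ R)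
    (hab : ‖u a‖ = ‖u b‖) (hp : p ∈ Icc a b) (hup : u p = 0) (hq : q ∈ Icc a b)
    (huq : ‖u q‖ = R) :
    ENNReal.ofReal (α * (b - a) / R + π * √(2 * α * R)) ≤ keplerAction α a b u := by
  have hba : 0 ≤ b - a := sub_nonneg.2 (hp.1.trans hp.2)
  let bound : ℝ → ℝ≥0∞ := fun δ =>
    ENNReal.ofReal (α / (R + 2 * δ)) * ENNReal.ofReal (b - a) +
      2 * ‖keplerCharacteristic α (R + 2 * δ) (R + δ) - keplerCharacteristic α (R + 2 * δ) δ‖ₑ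
  have hcont : ContinuousAt bound 0 := by
    have hne : R + 2 * 0 ≠ 0 := by simpa only [mul_zero, add_zero] using hR.ne'
    have h1 : ContinuousAt (fun δ => α / (R + 2 * δ)) 0 := by fun_prop (disch := assumption)
    have h2 : ContinuousAt (fun δ => keplerCharacteristic α (R + 2 * δ) (R + δ) -
        keplerCharacteristic α (R + 2 * δ) δ) 0 := by
      unfold keplerCharacteristic
      fun_prop (disch := assumption)
    exact (ENNReal.Tendsto.mul_const (ENNReal.tendsto_ofReal h1)
      (Or.inr ENNReal.ofReal_ne_top)).add
      (ENNReal.Tendsto.const_mul h2.enorm (Or.inr ENNReal.ofNat_ne_top))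
  have hbound : ∀ᶠ δ in 𝓝[>] 0, bound δ ≤ keplerAction α a b u := by
    filter_upwards [self_mem_nhdsWithin] with δ (hδ : 0 < δ)
    have h := add_two_mul_enorm_keplerCharacteristic_sub_le_keplerAction hα hδ hu
      (R := R + 2 * δ) (fun t ht => by linarith [hle t ht]) hab hp hq
    rwa [huq, hup, norm_zero, zero_add] at h
  have hzero : bound 0 = ENNReal.ofReal (α * (b - a) / R + π * √(2 * α * R)) := by
    simp only [bound, mul_zero, add_zero, keplerCharacteristic_zero, sub_zero,
      keplerCharacteristic_self hR.ne']
    rw [← ofReal_norm, Real.norm_of_nonneg (by positivity), ← ENNReal.ofReal_ofNat 2,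
      ← ENNReal.ofReal_mul (by positivity), ← ENNReal.ofReal_mul two_pos.le,
      ← ENNReal.ofReal_add (by positivity) (by positivity)]
    congr 1
    ring
  exact hzero ▸ le_of_tendsto (hcont.tendsto.mono_left nhdsWithin_le_nhds) hbound

theorem gordon_le_keplerAction (hα : 0 < α) (hab : a < b)
    (hu : AbsolutelyContinuousOnInterval u a b) (huab : ‖u a‖ = ‖u b‖) (hp : p ∈ Icc a b)
    (hup : u p = 0) :
    ENNReal.ofReal (3 * (π ^ 2 * α ^ 2 * (b - a) / 2) ^ (1 / 3 : ℝ)) ≤ keplerAction α a b u := by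
  have hcont : ContinuousOn (fun t => ‖u t‖) (Icc a b) :=
    uIcc_of_le hab.le ▸ hu.continuousOn.norm
  obtain ⟨q, hq, hmax⟩ := isCompact_Icc.exists_isMaxOn ⟨p, hp⟩ hcont
  rcases (norm_nonneg (u q)).eq_or_lt with hzero | hpos
  · rw [keplerAction_eq_top hα hab fun t ht => norm_le_zero_iff.1 ((hmax ht).trans hzero.ge)]
    exact le_top
  refine le_trans (ENNReal.ofReal_le_ofReal ?_)
    (ofReal_add_pi_mul_sqrt_le_keplerAction hα.le hu hpos (fun t ht => hmax ht) huab hp hup hq rfl)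
  have hba : 0 < b - a := sub_pos.2 hab
  have hsq : √(2 * α * ‖u q‖) ^ 2 = 2 * α * ‖u q‖ := Real.sq_sqrt (by positivity)
  calc 3 * (π ^ 2 * α ^ 2 * (b - a) / 2) ^ (1 / 3 : ℝ)
      = 3 * (α * (b - a) / ‖u q‖ * (π * √(2 * α * ‖u q‖) / 2) ^ 2) ^ (1 / 3 : ℝ) := by
        rw [div_pow, mul_pow, hsq]
        congr 2
        field_simp
    _ ≤ α * (b - a) / ‖u q‖ + 2 * (π * √(2 * α * ‖u q‖) / 2) :=
        three_mul_rpow_le_add_two_mul (by positivity) (by positivity)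
    _ = α * (b - a) / ‖u q‖ + π * √(2 * α * ‖u q‖) := by ring

end Kepler

section Satellites

variable {m₀ T t : ℝ} {u : ℝ → E3}

theorem kleinRot_zero (x : E3) : kleinRot 0 x = x := by
  simp [kleinRot, kleinMatrix]

theorem kleinRot_succ_apply (k : Fin 3) (x : E3) (j : Fin 3) :
    kleinRot k.succ x j = if j = k then x j else -x j := by
  fin_cases k <;> fin_cases j <;>
    simp [kleinRot, kleinMatrix, Matrix.mulVec, dotProduct, Fin.sum_univ_three]

theorem coordReflection_apply (j : Fin 3) (x : E3) (k : Fin 3) :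
    coordReflection j x k = if k = j then -x k else x k := by
  simp [coordReflection, Matrix.mulVec_diagonal]

theorem norm_eq_norm_of_forall_coord {x y : E3} (h : ∀ j, ‖x j‖ = ‖y j‖) : ‖x‖ = ‖y‖ := by
  simp only [EuclideanSpace.norm_eq, h]

theorem norm_kleinRot (i : Fin 4) (x : E3) : ‖kleinRot i x‖ = ‖x‖ := by
  cases i using Fin.cases with
  | zero => rw [kleinRot_zero]
  | succ k =>
    refine norm_eq_norm_of_forall_coord fun j => ?_
    rw [kleinRot_succ_apply, apply_ite norm, norm_neg, ite_self]

theorem norm_coordReflection (j : Fin 3) (x : E3) : ‖coordReflection j x‖ = ‖x‖ := by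
  refine norm_eq_norm_of_forall_coord fun k => ?_
  rw [coordReflection_apply, apply_ite norm, norm_neg, ite_self]

theorem kleinRot_succ_kleinRot_self (k : Fin 3) (x : E3) :
    kleinRot k.succ (kleinRot k.succ x) = x := by
  ext j
  simp only [kleinRot_succ_apply]
  split_ifs <;> simp only [neg_neg]

theorem kleinRot_succ_kleinRot_succ {k l m : Fin 3} (hkl : k ≠ l) (hlm : l ≠ m) (hmk : m ≠ k)
    (x : E3) : kleinRot k.succ (kleinRot l.succ x) = kleinRot m.succ x := by
  ext j
  obtain rfl | rfl | rfl : j = k ∨ j = l ∨ j = m := by omega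
  all_goals simp only [kleinRot_succ_apply, hkl, hlm, hmk, hkl.symm, hlm.symm, hmk.symm, if_true,
    if_false, neg_neg]

/-- The distance of a point from the `k`-th coordinate axis, the axis of `kleinRot k.succ`. -/
noncomputable def axisDist (k : Fin 3) (x : E3) : ℝ := ‖x - EuclideanSpace.single k (x k)‖

theorem axisDist_sq (k : Fin 3) (x : E3) : axisDist k x ^ 2 = ‖x‖ ^ 2 - x k ^ 2 := by
  rw [axisDist, norm_sub_sq_real, EuclideanSpace.inner_single_right, PiLp.norm_single,
    Real.norm_eq_abs, sq_abs, conj_trivial]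
  ring

theorem axisDist_le_norm (k : Fin 3) (x : E3) : axisDist k x ≤ ‖x‖ := by
  refine le_of_sq_le_sq ?_ (norm_nonneg x)
  linarith [axisDist_sq k x, sq_nonneg (x k)]

theorem norm_sub_kleinRot_succ (k : Fin 3) (x : E3) :
    ‖x - kleinRot k.succ x‖ = 2 * axisDist k x := by
  have h : x - kleinRot k.succ x = (2 : ℝ) • (x - EuclideanSpace.single k (x k)) := by
    ext j
    simp only [PiLp.sub_apply, PiLp.smul_apply, kleinRot_succ_apply, PiLp.single_apply,
      smul_eq_mul]
    split_ifs with hjk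
    · rw [hjk]; ring
    · ring
  rw [h, norm_smul, Real.norm_ofNat, axisDist]

theorem norm_kleinRot_succ_sub_kleinRot_succ {k l m : Fin 3} (hkl : k ≠ l) (hlm : l ≠ m)
    (hmk : m ≠ k) (x : E3) : ‖kleinRot k.succ x - kleinRot l.succ x‖ = 2 * axisDist m x := by
  rw [← norm_kleinRot k.succ, map_sub, kleinRot_succ_kleinRot_self,
    kleinRot_succ_kleinRot_succ hkl hlm hmk, norm_sub_kleinRot_succ]

theorem notMem_collisionSet_of_axisDist_pos {x : E3} (hx : ∀ k, 0 < axisDist k x) :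
    x ∉ collisionSet := by
  rintro ⟨i, hi, hfix⟩
  obtain ⟨k, rfl⟩ := Fin.exists_succ_eq_of_ne_zero hi
  have h := norm_sub_kleinRot_succ k x
  rw [hfix, sub_self, norm_zero] at h
  linarith [hx k]

theorem sum_sum_Ioi_fin_four {M : Type*} [AddCommMonoid M] (f : Fin 4 → Fin 4 → M) :
    ∑ i, ∑ j ∈ Finset.Ioi i, f i j = f 0 1 + (f 0 2 + f 0 3) + (f 1 2 + f 1 3) + f 2 3 := by
  rw [Fin.sum_univ_four, show Finset.Ioi (0 : Fin 4) = {1, 2, 3} by decide,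
    show Finset.Ioi (1 : Fin 4) = {2, 3} by decide, show Finset.Ioi (2 : Fin 4) = {3} by decide,
    show Finset.Ioi (3 : Fin 4) = ∅ by decide, Finset.sum_insert (by decide),
    Finset.sum_pair (by decide), Finset.sum_pair (by decide), Finset.sum_singleton,
    Finset.sum_empty, add_zero]

theorem one_div_enorm_add_one_div_enorm {E : Type*} [NormedAddCommGroup E] {y z : E} {d : ℝ}
    (hy : ‖y‖ = 2 * d) (hz : ‖z‖ = 2 * d) : 1 / ‖y‖ₑ + 1 / ‖z‖ₑ = 1 / ENNReal.ofReal d := by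
  rw [← ofReal_norm, ← ofReal_norm, hy, hz, ENNReal.ofReal_mul zero_le_two, ENNReal.ofReal_ofNat,
    one_div, one_div, ENNReal.mul_inv (Or.inl two_ne_zero) (Or.inl ENNReal.ofNat_ne_top),
    ← add_mul, ENNReal.inv_two_add_inv_two, one_mul]

theorem potential_kleinRot (m₀ : ℝ) (x : E3) :
    potential m₀ (fun i => kleinRot i x) =
      4 * (ENNReal.ofReal m₀ / ‖x‖ₑ) + ∑ k, 1 / ENNReal.ofReal (axisDist k x) := by
  have hcentral : ∀ i, ‖kleinRot i x‖ₑ = ‖x‖ₑ := fun i => by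
    rw [← ofReal_norm, norm_kleinRot, ofReal_norm]
  have hpair₀ := one_div_enorm_add_one_div_enorm (norm_sub_kleinRot_succ 0 x)
    (norm_kleinRot_succ_sub_kleinRot_succ (k := 1) (l := 2) (by decide) (by decide) (by decide) x)
  have hpair₁ := one_div_enorm_add_one_div_enorm (norm_sub_kleinRot_succ 1 x)
    (norm_kleinRot_succ_sub_kleinRot_succ (k := 0) (l := 2) (by decide) (by decide) (by decide) x)
  have hpair₂ := one_div_enorm_add_one_div_enorm (norm_sub_kleinRot_succ 2 x)
    (norm_kleinRot_succ_sub_kleinRot_succ (k := 0) (l := 1) (by decide) (by decide) (by decide) x)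
  simp only [Fin.succ_zero_eq_one, Fin.succ_one_eq_two, Fin.reduceSucc] at hpair₀ hpair₁ hpair₂
  simp only [potential, sum_sum_Ioi_fin_four, kleinRot_zero, hcentral, Fin.sum_univ_three,
    ← hpair₀, ← hpair₁, ← hpair₂, Finset.sum_const, Finset.card_univ, Fintype.card_fin,
    nsmul_eq_mul, Nat.cast_ofNat]
  ring

theorem kineticEnergy_satellites (hu : DifferentiableAt ℝ u t) :
    kineticEnergy (fun i => deriv (satellites u i) t) = 4 * (‖deriv u t‖ₑ ^ 2 / 2) := by
  have hspeed : ∀ i, ‖deriv (satellites u i) t‖ₑ = ‖deriv u t‖ₑ := fun i => by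
    have hderiv : HasDerivAt (satellites u i) (kleinRot i (deriv u t)) t :=
      (LinearMap.toContinuousLinearMap (kleinRot i)).hasFDerivAt.comp_hasDerivAt t hu.hasDerivAt
    rw [hderiv.deriv, ← ofReal_norm, norm_kleinRot, ofReal_norm]
  simp only [kineticEnergy, hspeed, Finset.sum_const, Finset.card_univ, Fintype.card_fin,
    nsmul_eq_mul, Nat.cast_ofNat, mul_div_assoc]

theorem four_mul_div_enorm_le_potential_kleinRot (hm₀ : 0 ≤ m₀) (x : E3) :
    4 * (ENNReal.ofReal (m₀ + 3 / 4) / ‖x‖ₑ) ≤ potential m₀ (fun i => kleinRot i x) := by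
  have hthree : 4 * ENNReal.ofReal (3 / 4) = 3 := by
    rw [← ENNReal.ofReal_ofNat 4, ← ENNReal.ofReal_mul (by norm_num)]
    norm_num
  calc 4 * (ENNReal.ofReal (m₀ + 3 / 4) / ‖x‖ₑ)
      = 4 * (ENNReal.ofReal m₀ / ‖x‖ₑ) + ∑ _k : Fin 3, 1 / ‖x‖ₑ := by
        rw [ENNReal.ofReal_add hm₀ (by norm_num), ENNReal.add_div, mul_add, ← mul_div_assoc,
          ← mul_div_assoc, hthree, Finset.sum_const, Finset.card_univ, Fintype.card_fin,
          nsmul_eq_mul, Nat.cast_ofNat, mul_one_div, mul_div_assoc]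
    _ ≤ 4 * (ENNReal.ofReal m₀ / ‖x‖ₑ) + ∑ k, 1 / ENNReal.ofReal (axisDist k x) := by
        gcongr with k
        rw [← ofReal_norm]
        exact ENNReal.ofReal_le_ofReal (axisDist_le_norm k x)
    _ = potential m₀ (fun i => kleinRot i x) := (potential_kleinRot m₀ x).symm

theorem four_mul_keplerAction_le_action (hm₀ : 0 ≤ m₀) (hT : 0 ≤ T)
    (hu : AbsolutelyContinuousOnInterval u 0 T) :
    4 * keplerAction (m₀ + 3 / 4) 0 T u ≤ action m₀ T u := by
  rw [keplerAction, ← lintegral_const_mul' _ _ ENNReal.ofNat_ne_top]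
  refine lintegral_mono_ae ?_
  filter_upwards [ae_differentiableAt_of_absolutelyContinuousOnInterval hu hT] with t ht
  rw [kineticEnergy_satellites ht, keplerLagrangian, mul_add]
  gcongr
  exact four_mul_div_enorm_le_potential_kleinRot hm₀ (u t)

theorem ofReal_le_action_of_eq_zero {p : ℝ} (hm₀ : 0 ≤ m₀) (hT : 0 < T)
    (hu : AbsolutelyContinuousOnInterval u 0 T) (hsymm : ∀ t, ‖u (t + T / 2)‖ = ‖u t‖)
    (hp : p ∈ Ico 0 (T / 2)) (hup : u p = 0) :
    ENNReal.ofReal (4 * (3 * (2 * π ^ 2 * (m₀ + 3 / 4) ^ 2 * T) ^ (1 / 3 : ℝ))) ≤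
      action m₀ T u := by
  have hhalf : 0 ≤ T / 2 := by positivity
  have hα : 0 < m₀ + 3 / 4 := by positivity
  set G := 3 * (π ^ 2 * (m₀ + 3 / 4) ^ 2 * (T / 2) / 2) ^ (1 / 3 : ℝ) with hG
  have hdouble : 3 * (2 * π ^ 2 * (m₀ + 3 / 4) ^ 2 * T) ^ (1 / 3 : ℝ) = G + G := by
    have hcbrt_eight : (8 : ℝ) ^ (1 / 3 : ℝ) = 2 := by
      rw [show (8 : ℝ) = 2 ^ (3 : ℝ) by norm_num, ← Real.rpow_mul two_pos.le]
      norm_num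
    rw [show 2 * π ^ 2 * (m₀ + 3 / 4) ^ 2 * T =
      8 * (π ^ 2 * (m₀ + 3 / 4) ^ 2 * (T / 2) / 2) by ring,
      Real.mul_rpow (by norm_num) (by positivity), hcbrt_eight, hG]
    ring
  have hfirst : ENNReal.ofReal G ≤ keplerAction (m₀ + 3 / 4) 0 (T / 2) u := by
    have h := gordon_le_keplerAction hα (half_pos hT)
      (absolutelyContinuousOnInterval_mono_Icc hu le_rfl hhalf (half_le_self hT.le))
      (by rw [← hsymm, zero_add]) (Ico_subset_Icc_self hp) hup
    rwa [sub_zero] at h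
  have hsecond : ENNReal.ofReal G ≤ keplerAction (m₀ + 3 / 4) (T / 2) T u := by
    have h := gordon_le_keplerAction hα (half_lt_self hT)
      (absolutelyContinuousOnInterval_mono_Icc hu hhalf (half_le_self hT.le) le_rfl)
      (by rw [← hsymm, add_halves]) (p := p + T / 2) ⟨by linarith [hp.1], by linarith [hp.2]⟩
      (by rw [← norm_eq_zero, hsymm, hup, norm_zero])
    rwa [sub_half] at h
  calc _ = 4 * (ENNReal.ofReal G + ENNReal.ofReal G) := by
        rw [hdouble, ENNReal.ofReal_mul (by norm_num), ENNReal.ofReal_ofNat,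
          ENNReal.ofReal_add (by positivity) (by positivity)]
    _ ≤ 4 * keplerAction (m₀ + 3 / 4) 0 T u := by
        rw [← keplerAction_add_adjacent hhalf (half_le_self hT.le)]
        gcongr
    _ ≤ action m₀ T u := four_mul_keplerAction_le_action hm₀ hT.le hu

end Satellites

section Closure

variable {T ε : ℝ} {u v : ℝ → E3} {K : Set (ℝ → E3)}

theorem subset_h1Closure (hK : ∀ v ∈ K, IsH1Loop T v) : K ⊆ h1Closure T K := fun v hv =>
  ⟨hK v hv, fun ε hε => ⟨v, hv, by simpa [h1Dist] using hε⟩⟩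

theorem h1Dist_sq (T : ℝ) (u v : ℝ → E3) :
    h1Dist T u v ^ 2 = ∫⁻ t in Ioc 0 T, (‖u t - v t‖ₑ ^ 2 + ‖deriv u t - deriv v t‖ₑ ^ 2) := by
  rw [h1Dist, ← ENNReal.rpow_natCast, ← ENNReal.rpow_mul]
  norm_num

theorem mul_sq_enorm_sub_le_h1Dist_sq (hT : 0 < T) (hu : IsH1Loop T u) (hv : IsH1Loop T v)
    (t : ℝ) : ENNReal.ofReal T * ‖u t - v t‖ₑ ^ 2 ≤
      (1 + ENNReal.ofReal T) * h1Dist T u v ^ 2 := by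
  have hac := hu.absolutelyContinuous.sub hv.absolutelyContinuous
  obtain ⟨s, hs, hts⟩ := (hu.periodic.sub hv.periodic).exists_mem_Ico₀ hT t
  simp only [Pi.sub_apply] at hts
  have h := mul_sq_enorm_le_lintegral hac (Ico_subset_Icc_self hs)
  rw [sub_zero, Pi.sub_apply, ← hts] at h
  refine h.trans (le_of_eq ?_)
  rw [h1Dist_sq]
  congr 1
  refine lintegral_congr_ae ?_
  filter_upwards [ae_differentiableAt_of_absolutelyContinuousOnInterval hu.absolutelyContinuous
      hT.le, ae_differentiableAt_of_absolutelyContinuousOnInterval hv.absolutelyContinuous hT.le]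
    with r hur hvr
  rw [deriv_sub hur hvr, Pi.sub_apply]

theorem exists_mem_forall_norm_sub_lt_of_mem_h1Closure (hT : 0 < T)
    (hK : ∀ v ∈ K, IsH1Loop T v) (hu : u ∈ h1Closure T K) (hε : 0 < ε) :
    ∃ v ∈ K, ∀ t, ‖u t - v t‖ < ε := by
  obtain ⟨η, hη0, hηsq⟩ : ∃ η, 0 < η ∧ (1 + T) * η ^ 2 = T * ε ^ 2 := by
    refine ⟨√(T / (1 + T)) * ε, by positivity, ?_⟩
    rw [mul_pow, Real.sq_sqrt (by positivity)]
    field_simp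
  obtain ⟨v, hv, hlt⟩ := hu.2 (ENNReal.ofReal η) (ENNReal.ofReal_pos.2 hη0)
  refine ⟨v, hv, fun t => ?_⟩
  have hsq : ENNReal.ofReal (T * ‖u t - v t‖ ^ 2) < ENNReal.ofReal (T * ε ^ 2) := by
    calc ENNReal.ofReal (T * ‖u t - v t‖ ^ 2) = ENNReal.ofReal T * ‖u t - v t‖ₑ ^ 2 := by
          rw [ENNReal.ofReal_mul hT.le, ENNReal.ofReal_pow (norm_nonneg _), ofReal_norm]
      _ ≤ (1 + ENNReal.ofReal T) * h1Dist T u v ^ 2 :=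
          mul_sq_enorm_sub_le_h1Dist_sq hT hu.1 (hK v hv) t
      _ < (1 + ENNReal.ofReal T) * ENNReal.ofReal η ^ 2 := by
          refine ENNReal.mul_lt_mul_right (by simp) (by finiteness) ?_
          gcongr
      _ = ENNReal.ofReal (T * ε ^ 2) := by
          rw [← hηsq, ENNReal.ofReal_mul (p := 1 + T) (by positivity), ENNReal.ofReal_pow hη0.le,
            ENNReal.ofReal_add one_pos.le hT.le, ENNReal.ofReal_one]
  have hsq_lt := (mul_lt_mul_iff_right₀ hT).1 ((ENNReal.ofReal_lt_ofReal_iff (by positivity)).1 hsq)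
  exact lt_of_pow_lt_pow_left₀ 2 hε.le hsq_lt

theorem norm_add_half_period_of_mem_admissibleLoops (hv : v ∈ admissibleLoops T) (t : ℝ) :
    ‖v (t + T / 2)‖ = ‖v t‖ := by
  obtain ⟨-, -, hreflect₂, hreflect₁, -, -⟩ := hv
  rw [hreflect₁ (t + T / 2), norm_coordReflection, hreflect₂ t, norm_coordReflection]
  congr 2
  ring

theorem norm_add_half_period_of_mem_h1Closure (hT : 0 < T)
    (hu : u ∈ h1Closure T (admissibleLoops T)) (t : ℝ) : ‖u (t + T / 2)‖ = ‖u t‖ := by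
  refine eq_of_forall_dist_le fun ε hε => ?_
  obtain ⟨v, hv, huv⟩ :=
    exists_mem_forall_norm_sub_lt_of_mem_h1Closure hT (fun v hv => hv.1) hu (half_pos hε)
  calc dist ‖u (t + T / 2)‖ ‖u t‖
      ≤ dist ‖u (t + T / 2)‖ ‖v (t + T / 2)‖ + dist ‖v t‖ ‖u t‖ := by
        rw [norm_add_half_period_of_mem_admissibleLoops hv]
        exact dist_triangle _ _ _
    _ ≤ ‖u (t + T / 2) - v (t + T / 2)‖ + ‖u t - v t‖ := by
        rw [dist_comm ‖v t‖]
        exact add_le_add (dist_norm_norm_le _ _) (dist_norm_norm_le _ _)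
    _ ≤ ε / 2 + ε / 2 := add_le_add (huv _).le (huv _).le
    _ = ε := add_halves ε

end Closure

section Competitor

variable {m₀ T b ω : ℝ}

theorem norm_sq_eq_coords (x : E3) : ‖x‖ ^ 2 = x 0 ^ 2 + x 1 ^ 2 + x 2 ^ 2 := by
  simp [EuclideanSpace.norm_sq_eq, Fin.sum_univ_three]

/-- A loop winding once around the first axis on the cylinder of radius `b`, while the first
coordinate oscillates twice. For `b, ω > 0` it keeps away from the three coordinate axes. -/
noncomputable def tennisLoop (b ω t : ℝ) : E3 :=
  !₂[b / 2 * Real.cos (2 * (ω * t)), b * Real.cos (ω * t), b * Real.sin (ω * t)]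

theorem hasDerivAt_tennisLoop (b ω t : ℝ) :
    HasDerivAt (tennisLoop b ω) !₂[-(b * ω * Real.sin (2 * (ω * t))), -(b * ω * Real.sin (ω * t)),
      b * ω * Real.cos (ω * t)] t := by
  have hangle : HasDerivAt (fun s => ω * s) ω t := by
    simpa using (hasDerivAt_id t).const_mul ω
  refine (PiLp.continuousLinearEquiv 2 ℝ fun _ : Fin 3 => ℝ).symm.hasFDerivAt.comp_hasDerivAt t
    (hasDerivAt_pi.2 fun i => ?_)
  fin_cases i
  · convert! ((hangle.const_mul 2).cos.const_mul (b / 2)) using 1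
    simp only [Fin.zero_eta, Matrix.cons_val_zero]
    ring
  · convert! (hangle.cos.const_mul b) using 1
    simp only [Fin.mk_one, Matrix.cons_val_one, Matrix.cons_val_zero]
    ring
  · convert! (hangle.sin.const_mul b) using 1
    simp only [Fin.reduceFinMk, Matrix.cons_val]
    ring

theorem contDiff_tennisLoop (b ω : ℝ) : ContDiff ℝ 1 (tennisLoop b ω) := by
  rw [contDiff_euclidean]
  intro i
  fin_cases i
  · exact (by fun_prop : ContDiff ℝ 1 fun t => b / 2 * Real.cos (2 * (ω * t)))
  · exact (by fun_prop : ContDiff ℝ 1 fun t => b * Real.cos (ω * t))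
  · exact (by fun_prop : ContDiff ℝ 1 fun t => b * Real.sin (ω * t))

theorem norm_deriv_tennisLoop_sq (b ω t : ℝ) :
    ‖deriv (tennisLoop b ω) t‖ ^ 2 = b ^ 2 * ω ^ 2 * (1 + Real.sin (2 * (ω * t)) ^ 2) := by
  rw [(hasDerivAt_tennisLoop b ω t).deriv, norm_sq_eq_coords]
  simp only [Matrix.cons_val]
  linear_combination b ^ 2 * ω ^ 2 * Real.sin_sq_add_cos_sq (ω * t)

theorem isH1Loop_tennisLoop (b : ℝ) (hω : ω * T = 2 * π) : IsH1Loop T (tennisLoop b ω) where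
  periodic t := by
    have hangle : ω * (t + T) = ω * t + 2 * π := by rw [mul_add, hω]
    have hangle_two : 2 * (ω * t + 2 * π) = 2 * (ω * t) + 2 * π + 2 * π := by ring
    simp only [tennisLoop, hangle, hangle_two, Real.cos_add_two_pi, Real.sin_add_two_pi]
  absolutelyContinuous := (contDiff_tennisLoop b ω).contDiffOn.absolutelyContinuousOnInterval
  memLp_deriv := by
    refine MemLp.of_bound ((contDiff_tennisLoop b ω).continuous_deriv le_rfl).aestronglyMeasurable
      (2 * |b * ω|) (Eventually.of_forall fun t => le_of_sq_le_sq ?_ (by positivity))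
    rw [norm_deriv_tennisLoop_sq, mul_pow, sq_abs, ← mul_pow, mul_comm]
    gcongr
    linarith [Real.sin_sq_le_one (2 * (ω * t))]

theorem axisDist_zero_tennisLoop_sq (b ω t : ℝ) : axisDist 0 (tennisLoop b ω t) ^ 2 = b ^ 2 := by
  rw [axisDist_sq, norm_sq_eq_coords]
  simp only [tennisLoop, Matrix.cons_val]
  linear_combination b ^ 2 * Real.sin_sq_add_cos_sq (ω * t)

theorem axisDist_one_tennisLoop_sq (b ω t : ℝ) :
    axisDist 1 (tennisLoop b ω t) ^ 2 = b ^ 2 * (1 / 4 + (Real.sin (ω * t) ^ 2) ^ 2) := by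
  rw [axisDist_sq, norm_sq_eq_coords]
  simp only [tennisLoop, Matrix.cons_val, Real.cos_two_mul, Real.cos_sq', mul_pow]
  ring

theorem axisDist_two_tennisLoop_sq (b ω t : ℝ) :
    axisDist 2 (tennisLoop b ω t) ^ 2 = b ^ 2 * (1 / 4 + (Real.cos (ω * t) ^ 2) ^ 2) := by
  rw [axisDist_sq, norm_sq_eq_coords]
  simp only [tennisLoop, Matrix.cons_val, Real.cos_two_mul]
  ring

theorem le_axisDist_zero_tennisLoop (b ω t : ℝ) : b ≤ axisDist 0 (tennisLoop b ω t) :=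
  le_of_sq_le_sq (axisDist_zero_tennisLoop_sq b ω t).ge (norm_nonneg _)

theorem half_le_axisDist_one_tennisLoop (b ω t : ℝ) :
    b / 2 ≤ axisDist 1 (tennisLoop b ω t) := by
  refine le_of_sq_le_sq ?_ (norm_nonneg _)
  rw [axisDist_one_tennisLoop_sq]
  linarith [mul_nonneg (sq_nonneg b) (sq_nonneg (Real.sin (ω * t) ^ 2))]

theorem half_le_axisDist_two_tennisLoop (b ω t : ℝ) :
    b / 2 ≤ axisDist 2 (tennisLoop b ω t) := by
  refine le_of_sq_le_sq ?_ (norm_nonneg _)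
  rw [axisDist_two_tennisLoop_sq]
  linarith [mul_nonneg (sq_nonneg b) (sq_nonneg (Real.cos (ω * t) ^ 2))]

theorem two_thirds_le_axisDist_tennisLoop (b ω t : ℝ) :
    2 * b / 3 ≤ axisDist 1 (tennisLoop b ω t) ∨ 2 * b / 3 ≤ axisDist 2 (tennisLoop b ω t) := by
  have hbound : ∀ q : ℝ, 1 / 2 ≤ q → (2 * b / 3) ^ 2 ≤ b ^ 2 * (1 / 4 + q ^ 2) := fun q hq => by
    nlinarith [mul_le_mul_of_nonneg_left (pow_le_pow_left₀ one_half_pos.le hq 2) (sq_nonneg b)]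
  rcases le_total (1 / 2) (Real.sin (ω * t) ^ 2) with hsin | hsin
  · exact .inl (le_of_sq_le_sq (axisDist_one_tennisLoop_sq b ω t ▸ hbound _ hsin) (norm_nonneg _))
  · have hcos : 1 / 2 ≤ Real.cos (ω * t) ^ 2 := by
      linarith [Real.sin_sq_add_cos_sq (ω * t)]
    exact .inr (le_of_sq_le_sq (axisDist_two_tennisLoop_sq b ω t ▸ hbound _ hcos) (norm_nonneg _))

theorem axisDist_tennisLoop_pos (hb : 0 < b) (ω t : ℝ) (k : Fin 3) :
    0 < axisDist k (tennisLoop b ω t) := by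
  fin_cases k
  · exact hb.trans_le (le_axisDist_zero_tennisLoop b ω t)
  · exact (half_pos hb).trans_le (half_le_axisDist_one_tennisLoop b ω t)
  · exact (half_pos hb).trans_le (half_le_axisDist_two_tennisLoop b ω t)

theorem tennisLoop_mem_admissibleLoops (hb : 0 < b) (hω : ω * T = 2 * π) :
    tennisLoop b ω ∈ admissibleLoops T := by
  refine ⟨isH1Loop_tennisLoop b hω,
    fun t => notMem_collisionSet_of_axisDist_pos (axisDist_tennisLoop_pos hb ω t),
    fun t => ?_, fun t => ?_, ⟨b / 2, b, by positivity, hb, ?_⟩, ⟨b / 2, b, by positivity, hb, ?_⟩⟩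
  · ext k
    rw [coordReflection_apply]
    fin_cases k <;> simp [tennisLoop]
  · have hangle : ω * (T / 2 - t) = π - ω * t := by linear_combination hω / 2
    have hangle_two : 2 * (π - ω * t) = 2 * π - 2 * (ω * t) := by ring
    ext k
    rw [coordReflection_apply]
    fin_cases k <;> simp [tennisLoop, hangle, hangle_two, Real.cos_two_pi_sub]
  · simp [tennisLoop]
  · have hangle : ω * (T / 4) = π / 2 := by linear_combination hω / 4
    simp [tennisLoop, hangle, mul_div_cancel₀]

theorem one_div_ofReal_le {c d : ℝ} (hc : 0 < c) (hcd : c ≤ d) :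
    1 / ENNReal.ofReal d ≤ ENNReal.ofReal (1 / c) := by
  rw [ENNReal.ofReal_div_of_pos hc, ENNReal.ofReal_one]
  gcongr

theorem sum_one_div_axisDist_tennisLoop_le (hb : 0 < b) (ω t : ℝ) :
    ∑ k, 1 / ENNReal.ofReal (axisDist k (tennisLoop b ω t)) ≤ ENNReal.ofReal (9 / 2 / b) := by
  obtain ⟨c₁, c₂, hc₁, hc₂, hle₁, hle₂, hsum⟩ : ∃ c₁ c₂ : ℝ, 0 < c₁ ∧ 0 < c₂ ∧
      c₁ ≤ axisDist 1 (tennisLoop b ω t) ∧ c₂ ≤ axisDist 2 (tennisLoop b ω t) ∧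
      1 / b + 1 / c₁ + 1 / c₂ = 9 / 2 / b := by
    rcases two_thirds_le_axisDist_tennisLoop b ω t with h | h
    · exact ⟨2 * b / 3, b / 2, by positivity, by positivity, h,
        half_le_axisDist_two_tennisLoop b ω t, by field_simp; norm_num⟩
    · exact ⟨b / 2, 2 * b / 3, by positivity, by positivity,
        half_le_axisDist_one_tennisLoop b ω t, h, by field_simp; norm_num⟩
  rw [← hsum, ENNReal.ofReal_add (by positivity) (by positivity),
    ENNReal.ofReal_add (by positivity) (by positivity), Fin.sum_univ_three]
  gcongr
  · exact one_div_ofReal_le hb (le_axisDist_zero_tennisLoop b ω t)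
  · exact one_div_ofReal_le hc₁ hle₁
  · exact one_div_ofReal_le hc₂ hle₂

theorem potential_satellites_tennisLoop_le (hm₀ : 0 ≤ m₀) (hb : 0 < b) (ω t : ℝ) :
    potential m₀ (fun i => satellites (tennisLoop b ω) i t) ≤
      ENNReal.ofReal (4 * ((m₀ + 9 / 8) / b)) := by
  have hnorm : b ≤ ‖tennisLoop b ω t‖ :=
    (le_axisDist_zero_tennisLoop b ω t).trans (axisDist_le_norm 0 _)
  calc potential m₀ (fun i => satellites (tennisLoop b ω) i t)
      = 4 * (ENNReal.ofReal m₀ / ‖tennisLoop b ω t‖ₑ) +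
          ∑ k, 1 / ENNReal.ofReal (axisDist k (tennisLoop b ω t)) := potential_kleinRot m₀ _
    _ ≤ 4 * (ENNReal.ofReal m₀ / ENNReal.ofReal b) + ENNReal.ofReal (9 / 2 / b) := by
        rw [← ofReal_norm (tennisLoop b ω t)]
        gcongr
        exact sum_one_div_axisDist_tennisLoop_le hb ω t
    _ = ENNReal.ofReal (4 * ((m₀ + 9 / 8) / b)) := by
        rw [← ENNReal.ofReal_div_of_pos hb, ← ENNReal.ofReal_ofNat 4,
          ← ENNReal.ofReal_mul (by positivity), ← ENNReal.ofReal_add (by positivity)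
          (by positivity)]
        congr 1
        ring

theorem lagrangian_tennisLoop_le (hm₀ : 0 ≤ m₀) (hb : 0 < b) (ω t : ℝ) :
    kineticEnergy (fun i => deriv (satellites (tennisLoop b ω) i) t) +
        potential m₀ (fun i => satellites (tennisLoop b ω) i t) ≤
      ENNReal.ofReal (2 * (b ^ 2 * ω ^ 2 * (1 + Real.sin (2 * (ω * t)) ^ 2)) +
        4 * ((m₀ + 9 / 8) / b)) := by
  rw [ENNReal.ofReal_add (by positivity) (by positivity)]
  refine add_le_add (le_of_eq ?_) (potential_satellites_tennisLoop_le hm₀ hb ω t)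
  have hdouble (x : ℝ) : 2 * x = 4 * (x / 2) := by ring
  rw [kineticEnergy_satellites (hasDerivAt_tennisLoop b ω t).differentiableAt,
    ← norm_deriv_tennisLoop_sq, hdouble, ENNReal.ofReal_mul (by norm_num),
    ENNReal.ofReal_div_of_pos two_pos, ENNReal.ofReal_pow (norm_nonneg _), ofReal_norm,
    ENNReal.ofReal_ofNat, ENNReal.ofReal_ofNat]

theorem integral_sin_two_mul_sq (hω : ω * T = 2 * π) :
    ∫ t in (0 : ℝ)..T, Real.sin (2 * (ω * t)) ^ 2 = T / 2 := by
  have hω₀ : ω ≠ 0 := left_ne_zero_of_mul (hω ▸ Real.two_pi_pos.ne')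
  have hend : 2 * ω * T = (4 : ℕ) * π := by push_cast; linear_combination 2 * hω
  simp only [← mul_assoc]
  rw [intervalIntegral.integral_comp_mul_left (fun x => Real.sin x ^ 2)
    (mul_ne_zero two_ne_zero hω₀), integral_sin_sq, hend, Real.sin_nat_mul_pi, ← hend, smul_eq_mul,
    mul_zero, Real.sin_zero]
  field_simp
  ring

theorem action_tennisLoop_le (hm₀ : 0 ≤ m₀) (hT : 0 < T) (hb : 0 < b) (hω : ω * T = 2 * π) :
    action m₀ T (tennisLoop b ω) ≤
      ENNReal.ofReal (4 * (T * (3 / 4 * b ^ 2 * ω ^ 2 + (m₀ + 9 / 8) / b))) := by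
  have hsin : IntervalIntegrable (fun t => Real.sin (2 * (ω * t)) ^ 2) volume 0 T :=
    Continuous.intervalIntegrable (by fun_prop) 0 T
  refine (lintegral_mono fun t => lagrangian_tennisLoop_le hm₀ hb ω t).trans ?_
  rw [← ofReal_integral_eq_lintegral_ofReal
    (Continuous.intervalIntegrable (by fun_prop) 0 T).1
    (Eventually.of_forall fun t => by positivity), ← intervalIntegral.integral_of_le hT.le,
    intervalIntegral.integral_add (Continuous.intervalIntegrable (by fun_prop) 0 T)
      intervalIntegrable_const, intervalIntegral.integral_const_mul,
    intervalIntegral.integral_const_mul,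
    intervalIntegral.integral_add intervalIntegrable_const hsin, integral_sin_two_mul_sq hω,
    intervalIntegral.integral_const, intervalIntegral.integral_const, smul_eq_mul, smul_eq_mul]
  refine ENNReal.ofReal_le_ofReal (le_of_eq ?_)
  ring

theorem exists_mem_admissibleLoops_action_le (hm₀ : 0 ≤ m₀) (hT : 0 < T) :
    ∃ v ∈ admissibleLoops T, action m₀ T v ≤
      ENNReal.ofReal (4 * (3 * (3 * π ^ 2 * (m₀ + 9 / 8) ^ 2 * T / 4) ^ (1 / 3 : ℝ))) := by
  set g := (3 * π ^ 2 * (m₀ + 9 / 8) ^ 2 * T / 4) ^ (1 / 3 : ℝ) with hg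
  have hg₀ : 0 < g := by positivity
  have hg₃ : g ^ 3 = 3 * π ^ 2 * (m₀ + 9 / 8) ^ 2 * T / 4 := by
    rw [hg, ← Real.rpow_mul_natCast (by positivity)]
    norm_num
  -- The radius minimizes the bound of `action_tennisLoop_le`.
  have hb : 0 < (m₀ + 9 / 8) * T / (2 * g) := by positivity
  have hω : 2 * π / T * T = 2 * π := div_mul_cancel₀ _ hT.ne'
  refine ⟨_, tennisLoop_mem_admissibleLoops hb hω, (action_tennisLoop_le hm₀ hT hb hω).trans
    (ENNReal.ofReal_le_ofReal (le_of_eq ?_))⟩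
  field_simp
  linear_combination (-256) * hg₃

theorem rpow_competitor_lt_rpow_collision (hm₀ : 0 ≤ m₀) (hT : 0 < T) :
    (3 * π ^ 2 * (m₀ + 9 / 8) ^ 2 * T / 4) ^ (1 / 3 : ℝ) <
      (2 * π ^ 2 * (m₀ + 3 / 4) ^ 2 * T) ^ (1 / 3 : ℝ) := by
  refine Real.rpow_lt_rpow (by positivity) ?_ (by norm_num)
  have hmass : 3 * (m₀ + 9 / 8) ^ 2 / 4 < 2 * (m₀ + 3 / 4) ^ 2 := by nlinarith
  calc 3 * π ^ 2 * (m₀ + 9 / 8) ^ 2 * T / 4 = π ^ 2 * T * (3 * (m₀ + 9 / 8) ^ 2 / 4) := by ring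
    _ < π ^ 2 * T * (2 * (m₀ + 3 / 4) ^ 2) := by gcongr
    _ = 2 * π ^ 2 * (m₀ + 3 / 4) ^ 2 * T := by ring

end Competitor

end KleinSatellites

theorem mainTheorem8 (m₀ T : ℝ) (hm₀ : 0 ≤ m₀) (hT : 0 < T) (u : ℝ → KleinSatellites.E3)
    (hu : u ∈ KleinSatellites.h1Closure T (KleinSatellites.admissibleLoops T))
    (hmin : IsMinOn (KleinSatellites.action m₀ T)
      (KleinSatellites.h1Closure T (KleinSatellites.admissibleLoops T)) u) :
    ¬ KleinSatellites.HasTotalCollision u := by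
  rintro ⟨t, hcollision⟩
  have hut : ‖u t‖ = 0 := by
    rw [← KleinSatellites.norm_kleinRot 0, norm_eq_zero]
    exact hcollision 0
  have hsymm := KleinSatellites.norm_add_half_period_of_mem_h1Closure hT hu
  have hperiodic : Function.Periodic (fun s => ‖u s‖) (T / 2) := hsymm
  obtain ⟨p, hp, hup⟩ := hperiodic.exists_mem_Ico₀ (half_pos hT) t
  have hlower := KleinSatellites.ofReal_le_action_of_eq_zero hm₀ hT hu.1.absolutelyContinuous
    hsymm hp (norm_eq_zero.1 (hup.symm.trans hut))
  obtain ⟨v, hv, hupper⟩ := KleinSatellites.exists_mem_admissibleLoops_action_le hm₀ hT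
  have huv : KleinSatellites.action m₀ T u ≤ KleinSatellites.action m₀ T v :=
    hmin (KleinSatellites.subset_h1Closure (fun w hw => hw.1) hv)
  refine (hlower.trans (huv.trans hupper)).not_gt
    ((ENNReal.ofReal_lt_ofReal_iff (by positivity)).2 ?_)
  linarith [KleinSatellites.rpow_competitor_lt_rpow_collision hm₀ hT]
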